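/- For $n\ge 1$ let $B_n$ be the Boolean graph: its vertices are the nonempty proper subsets of $\{1,\dots,n\}$, and two vertices $M,N$ are adjacent if and only if $M\cap N=\varnothing$. For a finite simple graph $G$ let $\Delta_G$ be the clique complex of the complement of $G$, that is, the simplicial complex of independent sets of $G$ (the empty set being a face). A simplicial complex $\Delta$ is vertex decomposable if it is a simplex (all subsets of one finite set, which may be empty), or if it has a vertex $x$ such that both the deletion $\Delta\setminus x=\{F\in\Delta: x\notin F\}$ and the link $\mathrm{lk}_\Delta(x)=\{F\in\Delta: x\notin F,\ F\cup\{x\}\in\Delta\}$ are vertex decomposable and no facet of $\mathrm{lk}_\Delta(x)$ is a facet of $\Delta\setminus x$. A graph $G$ is vertex decomposable if $\Delta_G$ is, and it is Cohen--Macaulay over a field $K$ if the Stanley--Reisner ring $K[\Delta_G]=K[x_v : v\in V(G)]/(x_ux_v : \{u,v\}\in E(G))$ is a Cohen--Macaulay ring. Then for every $n\ge 1$ the graph $B_n$ is vertex decomposable, and it is Cohen--Macaulay over every field $K$. -/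

import Mathlib

universe u v

/-! ## Simplicial complexes and vertex decomposability -/

/-- A simplicial complex on the ambient set `V`: a nonempty hereditary family of finite sets.
The empty set is a face (as is needed for links and facets), and the points of `V` that are not
faces are simply not vertices of the complex, so that deletions and links live on the same `V`. -/
@[ext]
structure FaceComplex (V : Type u) where
  faces : Set (Finset V)
  empty_mem : ∅ ∈ faces
  down_closed : ∀ ⦃F H : Finset V⦄, F ∈ faces → H ⊆ F → H ∈ faces

namespace FaceComplex

variable {V : Type u}

/-- `x` is a vertex of the complex. -/
def IsVertex (Δ : FaceComplex V) (x : V) : Prop := {x} ∈ Δ.faces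

/-- A facet is a face that is maximal under inclusion. -/
def IsFacet (Δ : FaceComplex V) (F : Finset V) : Prop := Maximal (· ∈ Δ.faces) F

/-- The complex is a simplex: it consists of all subsets of one finite set. -/
def IsSimplex (Δ : FaceComplex V) : Prop := ∃ s : Finset V, ∀ F, F ∈ Δ.faces ↔ F ⊆ s

/-- The deletion `Δ \ x = {F ∈ Δ | x ∉ F}`. -/
def deletion (Δ : FaceComplex V) (x : V) : FaceComplex V where
  faces := {F | F ∈ Δ.faces ∧ x ∉ F}
  empty_mem := ⟨Δ.empty_mem, Finset.notMem_empty x⟩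
  down_closed := fun _ _ hF hHF => ⟨Δ.down_closed hF.1 hHF, fun hx => hF.2 (hHF hx)⟩

/-- The link `{F ∈ Δ | x ∉ F, F ∪ {x} ∈ Δ}` of a vertex `x`. -/
def link [DecidableEq V] (Δ : FaceComplex V) (x : V) (hx : Δ.IsVertex x) : FaceComplex V where
  faces := {F | F ∈ Δ.faces ∧ x ∉ F ∧ insert x F ∈ Δ.faces}
  empty_mem := ⟨Δ.empty_mem, Finset.notMem_empty x, hx⟩
  down_closed := fun _ _ hF hHF =>
    ⟨Δ.down_closed hF.1 hHF, fun h => hF.2.1 (hHF h),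
      Δ.down_closed hF.2.2 (Finset.insert_subset_insert x hHF)⟩

/-- Vertex decomposability (not necessarily pure): a simplex is vertex decomposable, and so is a
complex with a vertex whose deletion and link are vertex decomposable and such that no facet of
the link is a facet of the deletion. -/
inductive IsVertexDecomposable [DecidableEq V] : FaceComplex V → Prop
  | simplex (Δ : FaceComplex V) (h : Δ.IsSimplex) : IsVertexDecomposable Δ
  | shedding (Δ : FaceComplex V) (x : V) (hx : Δ.IsVertex x)
      (hdel : IsVertexDecomposable (Δ.deletion x))
      (hlink : IsVertexDecomposable (Δ.link x hx))
      (hshed : ∀ F, (Δ.link x hx).IsFacet F → ¬ (Δ.deletion x).IsFacet F) :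
      IsVertexDecomposable Δ

/-- The Stanley–Reisner ideal in `K[x_v | v ∈ V]`, generated by the squarefree monomials of the
non-faces. -/
noncomputable def stanleyReisnerIdeal (K : Type v) [Field K] (Δ : FaceComplex V) : Ideal (MvPolynomial V K) :=
  Ideal.span {m | ∃ F : Finset V, F ∉ Δ.faces ∧ m = ∏ i ∈ F, MvPolynomial.X i}

/-- The Stanley–Reisner ring `K[Δ]`. -/
abbrev StanleyReisnerRing (K : Type v) [Field K] (Δ : FaceComplex V) : Type (max u v) :=
  MvPolynomial V K ⧸ Δ.stanleyReisnerIdeal K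

end FaceComplex

/-! ## Cohen–Macaulay rings -/

/-- The depth of a local ring: the supremum of the lengths of the regular sequences in its
maximal ideal. -/
noncomputable def localDepth (R : Type u) [CommRing R] [IsLocalRing R] : ℕ∞ :=
  ⨆ rs : {rs : List R // (∀ r ∈ rs, r ∈ IsLocalRing.maximalIdeal R) ∧
    RingTheory.Sequence.IsRegular R rs}, (rs.1.length : ℕ∞)

/-- A Cohen–Macaulay ring: a Noetherian ring all of whose localizations at prime ideals have
depth equal to their Krull dimension. -/
def IsCohenMacaulayRing (R : Type u) [CommRing R] : Prop :=
  IsNoetherianRing R ∧ ∀ (p : Ideal R) [p.IsPrime],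
    ((localDepth (Localization.AtPrime p) : ℕ∞) : WithBot ℕ∞) =
      ringKrullDim (Localization.AtPrime p)

/-! ## Graphs -/

namespace SimpleGraph

variable {V : Type u}

/-- The clique complex of a graph. -/
def cliqueFaceComplex (G : SimpleGraph V) : FaceComplex V where
  faces := {F | G.IsClique (F : Set V)}
  empty_mem := by simp
  down_closed := fun _ _ hF hHF => hF.subset (Finset.coe_subset.mpr hHF)

/-- The complex `Δ_G` of a graph `G`: the clique complex of the complement of `G`, whose faces are
the independent sets of `G`. -/
def indepFaceComplex (G : SimpleGraph V) : FaceComplex V := Gᶜ.cliqueFaceComplex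

/-- A graph is vertex decomposable if `Δ_G` is. -/
def IsVertexDecomposable [DecidableEq V] (G : SimpleGraph V) : Prop :=
  G.indepFaceComplex.IsVertexDecomposable

/-- A graph is Cohen–Macaulay over `K` if the Stanley–Reisner ring `K[Δ_G]` is a Cohen–Macaulay
ring; the Stanley–Reisner ideal of `Δ_G` is the edge ideal of `G`. -/
def IsCohenMacaulayOver (G : SimpleGraph V) (K : Type v) [Field K] : Prop :=
  IsCohenMacaulayRing (G.indepFaceComplex.StanleyReisnerRing K)

end SimpleGraph

/-- The vertices of the Boolean graph: the nonempty proper subsets of an `n`-element set. -/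
abbrev BooleanVertex (n : ℕ) : Type := {A : Finset (Fin n) // A ≠ ∅ ∧ A ≠ Finset.univ}

/-- The Boolean graph `B_n`: two nonempty proper subsets are adjacent when they are disjoint. -/
def booleanGraph (n : ℕ) : SimpleGraph (BooleanVertex n) where
  Adj A B := A.1 ∩ B.1 = ∅
  symm := ⟨fun A B h => by rwa [Finset.inter_comm]⟩
  loopless := ⟨fun A h => A.2.1 (by rwa [Finset.inter_self] at h)⟩

/-!
Order the vertices of `B_n` by inclusion; then `A` and `B` are adjacent exactly when `A ≤ Bᶜ`.
If `A` is minimal among the vertices still present whose complement is also present, then `Aᶜ` is a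
leaf with neighbour `A`. The independent sets therefore remain independent when `Aᶜ` is added after
`A` has been deleted, so `A` is a shedding vertex. Repeating this ends with an independent set,
whose complex is a simplex.

For the Cohen–Macaulay property, let `S` be the polynomial ring with one variable for each pair
`{A, Aᶜ}`, acting on `K[Δ]` through the sums `X_A + X_{Aᶜ}`. Each `X_A` is integral over `S`, as a
root of `T (T - (X_A + X_{Aᶜ}))`. The exact sequences `0 → K[star A] → K[Δ] → K[Δ \ A] → 0` of the
same peeling reduce the projectivity of `K[Δ]` over `S` to simplices on one vertex of each pair,
whose rings are `S` itself. A flat integral extension of a regular ring is Cohen–Macaulay.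
-/

/-! ## Regular rings and flat integral extensions -/

section CohenMacaulay

open IsLocalRing RingTheory.Sequence Ideal

theorem exists_isPrime_ringKrullDim_le_quotient (R : Type*) [CommRing R] [FiniteRingKrullDim R] :
    ∃ P : Ideal R, P.IsPrime ∧ ringKrullDim R ≤ ringKrullDim (R ⧸ P) := by
  let l := LTSeries.longestOf (PrimeSpectrum R)
  refine ⟨l.head.asIdeal, l.head.isPrime, ?_⟩
  rw [ringKrullDim_quotient, ringKrullDim, Order.krullDim_eq_length_of_finiteDimensionalOrder]
  exact Order.le_krullDim_iff.mpr
    ⟨⟨l.length, fun i => ⟨l i, LTSeries.head_le l i⟩, l.step⟩, rfl⟩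

theorem ringKrullDim_le_ringKrullDim_quotient_span_singleton_add_one {R : Type*} [CommRing R]
    [IsNoetherianRing R] [IsLocalRing R] {r : R} (hr : r ∈ maximalIdeal R) :
    ringKrullDim R ≤ ringKrullDim (R ⧸ span {r}) + 1 := by
  simpa using ringKrullDim_le_ringKrullDim_quotient_add_encard {r}
    (by simpa [ringJacobson_eq_maximalIdeal] using hr)

theorem eq_bot_of_isPrime_of_le_span_singleton {R : Type*} [CommRing R] [IsNoetherianRing R]
    [IsLocalRing R] {r : R} (hr : r ∈ maximalIdeal R) {P : Ideal R} [hP : P.IsPrime] (hrP : r ∉ P)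
    (hle : P ≤ span {r}) : P = ⊥ := by
  refine Submodule.eq_bot_of_le_smul_of_le_jacobson_bot (span {r}) P P.fg_of_isNoetherianRing ?_
    ((span_singleton_le_iff_mem _).mpr (maximalIdeal_le_jacobson _ hr))
  intro x hx
  obtain ⟨y, rfl⟩ := mem_span_singleton.mp (hle hx)
  exact Submodule.smul_mem_smul (mem_span_singleton_self r)
    ((hP.mem_or_mem hx).resolve_left hrP)

theorem le_span_singleton_of_ringKrullDim_lt {R : Type*} [CommRing R] [IsNoetherianRing R]
    [IsLocalRing R] {r : R} [IsDomain (R ⧸ span {r})] (hr : r ∈ maximalIdeal R) {P : Ideal R}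
    [P.IsPrime] (hlt : ringKrullDim (R ⧸ span {r}) < ringKrullDim (R ⧸ P)) : P ≤ span {r} := by
  by_contra hle
  obtain ⟨p, hpP, hp⟩ := SetLike.not_le_iff_exists.mp hle
  let mkP := Ideal.Quotient.mk P
  have hmkP : Function.Surjective mkP := Ideal.Quotient.mk_surjective
  let f : R ⧸ span {r} →+* (R ⧸ P) ⧸ span {mkP r} :=
    quotientMap _ mkP ((span_singleton_le_iff_mem _).mpr (mem_span_singleton_self _))
  have hfp : f (Ideal.Quotient.mk _ p) = 0 := by
    simp [f, mkP, Ideal.Quotient.eq_zero_iff_mem.mpr hpP]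
  have := IsLocalRing.of_surjective' mkP hmkP
  have hmkr : mkP r ∈ maximalIdeal (R ⧸ P) :=
    map_maximalIdeal_of_surjective mkP hmkP ▸ mem_map_of_mem mkP hr
  refine hlt.not_ge ?_
  calc ringKrullDim (R ⧸ P)
      ≤ ringKrullDim ((R ⧸ P) ⧸ span {mkP r}) + 1 :=
        ringKrullDim_le_ringKrullDim_quotient_span_singleton_add_one hmkr
    _ ≤ ringKrullDim (R ⧸ span {r}) :=
        ringKrullDim_succ_le_of_surjective f (quotientMap_surjective hmkP)
          (mem_nonZeroDivisors_of_ne_zero (mt Ideal.Quotient.eq_zero_iff_mem.mp hp)) hfp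

theorem isDomain_of_ringKrullDim_quotient_span_singleton_lt {R : Type*} [CommRing R]
    [IsNoetherianRing R] [IsLocalRing R] {r : R} [IsDomain (R ⧸ span {r})]
    (hr : r ∈ maximalIdeal R) (hlt : ringKrullDim (R ⧸ span {r}) < ringKrullDim R) :
    IsDomain R := by
  -- A prime `P` with `dim R / P = dim R` lies in `(r)` but does not contain `r`; then `P = r P`,
  -- and Nakayama's lemma gives `P = 0`.
  obtain ⟨P, hP, hdim⟩ := exists_isPrime_ringKrullDim_le_quotient R
  have hrP : r ∉ P := fun h => (hlt.trans_le hdim).not_ge <|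
    ringKrullDim_le_of_surjective (Ideal.Quotient.factor ((span_singleton_le_iff_mem P).mpr h))
      (Ideal.Quotient.factor_surjective _)
  have hP_bot : P = ⊥ := eq_bot_of_isPrime_of_le_span_singleton hr hrP
    (le_span_singleton_of_ringKrullDim_lt hr (hlt.trans_le hdim))
  exact IsDomain.of_bot_isPrime R (hbp := hP_bot ▸ hP)

theorem ringKrullDim_le_length_of_maximalIdeal_eq_ofList {R : Type*} [CommRing R]
    [IsNoetherianRing R] [IsLocalRing R] {rs : List R} (hrs : maximalIdeal R = ofList rs) :
    ringKrullDim R ≤ rs.length := by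
  classical
  refine (ringKrullDim_le_spanFinrank_maximalIdeal R).trans (Nat.cast_le.mpr ?_)
  rw [hrs, ofList, ← List.coe_toFinset]
  refine (Submodule.spanFinrank_span_le_ncard_of_finite (R := R) rs.toFinset.finite_toSet).trans ?_
  rw [Set.ncard_coe_finset]
  exact rs.toFinset_card_le

theorem maximalIdeal_quotient_eq_ofList {R : Type*} [CommRing R] [IsLocalRing R] {r : R}
    {rs : List R} [IsLocalRing (R ⧸ span {r})] (hrs : maximalIdeal R = ofList (r :: rs)) :
    maximalIdeal (R ⧸ span {r}) = ofList (rs.map (algebraMap R (R ⧸ span {r}))) := by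
  rw [← map_maximalIdeal_of_surjective _ Ideal.Quotient.mk_surjective, hrs, ofList_cons,
    Ideal.map_sup, map_quotient_self, bot_sup_eq, map_ofList, Ideal.Quotient.algebraMap_eq]

theorem isWeaklyRegular_cons_of_quotient {R : Type*} [CommRing R] [IsDomain R] {r : R}
    {rs : List R} (hr : r ≠ 0)
    (hrs : IsWeaklyRegular (R ⧸ span {r}) (rs.map (algebraMap R (R ⧸ span {r})))) :
    IsWeaklyRegular R (r :: rs) := by
  rw [isWeaklyRegular_map_algebraMap_iff] at hrs
  refine .cons (IsRegular.of_ne_zero hr).left.isSMulRegular ?_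
  have e : (R ⧸ span {r}) ≃ₗ[R] QuotSMulTop r R :=
    Submodule.quotEquivOfEq _ _ (by simp [← Submodule.ideal_span_singleton_smul])
  exact (e.isWeaklyRegular_congr rs).mp hrs

theorem isDomain_and_isWeaklyRegular_of_maximalIdeal_eq_ofList {n : ℕ} {R : Type*} [CommRing R]
    [IsNoetherianRing R] [IsLocalRing R] {rs : List R} (hn : rs.length = n)
    (hrs : maximalIdeal R = ofList rs) (hdim : n ≤ ringKrullDim R) :
    IsDomain R ∧ IsWeaklyRegular R rs := by
  induction n generalizing R with
  | zero =>
    obtain rfl := List.length_eq_zero_iff.mp hn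
    exact ⟨(isField_iff_maximalIdeal_eq.mpr (hrs.trans ofList_nil)).isDomain, .nil _ _⟩
  | succ n ih =>
    obtain ⟨r, rs, rfl⟩ := List.exists_of_length_succ _ hn
    have hr : r ∈ maximalIdeal R := hrs ▸ subset_span List.mem_cons_self
    have : Nontrivial (R ⧸ span {r}) :=
      Ideal.Quotient.nontrivial_iff.mpr (span_singleton_ne_top hr)
    have := IsLocalRing.of_surjective' (Ideal.Quotient.mk (span {r})) Ideal.Quotient.mk_surjective
    have hmax := maximalIdeal_quotient_eq_ofList hrs
    have hlen : (rs.map (algebraMap R (R ⧸ span {r}))).length = n := by simpa using hn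
    have hge : n ≤ ringKrullDim (R ⧸ span {r}) := by
      rw [← ENat.WithBot.add_le_add_one_right_iff, ← Nat.cast_succ]
      exact hdim.trans (ringKrullDim_le_ringKrullDim_quotient_span_singleton_add_one hr)
    obtain ⟨_, hreg⟩ := ih hlen hmax hge
    have hlt : ringKrullDim (R ⧸ span {r}) < ringKrullDim R :=
      calc ringKrullDim (R ⧸ span {r}) ≤ n :=
            hlen ▸ ringKrullDim_le_length_of_maximalIdeal_eq_ofList hmax
        _ < (n + 1 : ℕ) := Nat.cast_lt.mpr n.lt_succ_self
        _ ≤ ringKrullDim R := hdim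
    have := isDomain_of_ringKrullDim_quotient_span_singleton_lt hr hlt
    have hr0 : r ≠ 0 := by
      rintro rfl
      exact hlt.ne (ringKrullDim_eq_of_ringEquiv
        ((quotEquivOfEq (span_singleton_eq_bot.mpr rfl)).trans (RingEquiv.quotientBot R)))
    exact ⟨this, isWeaklyRegular_cons_of_quotient hr0 hreg⟩

/-- A local ring with a weakly regular sequence in its maximal ideal that is at least as long as
its Krull dimension. For Noetherian rings this says that the ring is Cohen–Macaulay. -/
def HasLongRegularSequence (R : Type*) [CommRing R] [IsLocalRing R] : Prop :=
  ∃ rs : List R, (∀ r ∈ rs, r ∈ maximalIdeal R) ∧ IsWeaklyRegular R rs ∧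
    ringKrullDim R ≤ rs.length

theorem HasLongRegularSequence.of_isRegularLocalRing (R : Type*) [CommRing R]
    [IsRegularLocalRing R] : HasLongRegularSequence R := by
  obtain ⟨s, hcard, hspan⟩ :=
    Submodule.FG.exists_span_finset_card_eq_spanFinrank (maximalIdeal R).fg_of_isNoetherianRing
  have hdim : (s.card : WithBot ℕ∞) = ringKrullDim R := by
    rw [hcard, IsRegularLocalRing.spanFinrank_maximalIdeal]
  have hs : maximalIdeal R = ofList s.toList := by simp [ofList, ← hspan, span]
  have hreg := (isDomain_and_isWeaklyRegular_of_maximalIdeal_eq_ofList s.length_toList hs hdim.le).2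
  exact ⟨s.toList, fun r hr => hs ▸ subset_span (s := {r | r ∈ s.toList}) hr, hreg, by simp [hdim]⟩

theorem localDepth_le_ringKrullDim (R : Type*) [CommRing R] [IsLocalRing R]
    [IsNoetherianRing R] : ((localDepth R : ℕ∞) : WithBot ℕ∞) ≤ ringKrullDim R := by
  rw [← maximalIdeal_height_eq_ringKrullDim, WithBot.coe_le_coe]
  refine iSup_le fun rs => ?_
  have := ringKrullDim_add_length_eq_ringKrullDim_of_isRegular rs.1 rs.2.2
  rw [← WithBot.coe_le_coe, maximalIdeal_height_eq_ringKrullDim, ← this]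
  have hne : Ideal.ofList rs.1 ≠ ⊤ := by simpa using rs.2.2.2.symm
  have : Nontrivial (R ⧸ Ideal.ofList rs.1) := Ideal.Quotient.nontrivial_iff.mpr hne
  have h0 : 0 ≤ ringKrullDim (R ⧸ Ideal.ofList rs.1) := ringKrullDim_nonneg_of_nontrivial
  calc (((rs.1.length : ℕ∞) : WithBot ℕ∞)) = 0 + (rs.1.length : WithBot ℕ∞) := by simp
    _ ≤ _ := by gcongr

theorem localDepth_eq_ringKrullDim_iff (R : Type*) [CommRing R] [IsLocalRing R]
    [IsNoetherianRing R] :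
    ((localDepth R : ℕ∞) : WithBot ℕ∞) = ringKrullDim R ↔ HasLongRegularSequence R := by
  constructor
  · intro h
    have hlt : localDepth R < ⊤ := by
      rw [← maximalIdeal_height_eq_ringKrullDim, WithBot.coe_inj] at h
      rw [h]
      exact Ideal.height_lt_top Ideal.IsPrime.ne_top'
    have : Nonempty {rs : List R // (∀ r ∈ rs, r ∈ maximalIdeal R) ∧ IsRegular R rs} :=
      ⟨⟨[], by simp, IsRegular.nil R R⟩⟩
    obtain ⟨rs, hrs⟩ := ENat.exists_eq_iSup_of_lt_top hlt
    refine ⟨rs.1, rs.2.1, rs.2.2.1, ?_⟩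
    rw [← h, localDepth, ← hrs]
    rfl
  · rintro ⟨rs, hmem, hreg, hdim⟩
    refine le_antisymm (localDepth_le_ringKrullDim R) (hdim.trans ?_)
    have := le_iSup (fun rs : {rs : List R // (∀ r ∈ rs, r ∈ maximalIdeal R) ∧ IsRegular R rs} =>
      (rs.1.length : ℕ∞)) ⟨rs, hmem,
        (isRegular_iff_isWeaklyRegular_of_subset_maximalIdeal hmem).mpr hreg⟩
    exact WithBot.coe_le_coe.mpr this

theorem isCohenMacaulayRing_iff (R : Type*) [CommRing R] [IsNoetherianRing R] :
    IsCohenMacaulayRing R ↔ ∀ (p : Ideal R) [p.IsPrime],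
      HasLongRegularSequence (Localization.AtPrime p) := by
  simp only [IsCohenMacaulayRing, localDepth_eq_ringKrullDim_iff, and_iff_right_iff_imp]
  intro _
  infer_instance

theorem IsCohenMacaulayRing.of_isRegularRing (R : Type*) [CommRing R] [IsRegularRing R] :
    IsCohenMacaulayRing R :=
  (isCohenMacaulayRing_iff R).mpr fun _ _ => .of_isRegularLocalRing _

theorem height_le_height_under_of_isIntegral {A R : Type*} [CommRing A] [CommRing R]
    [Algebra A R] [Algebra.IsIntegral A R] (p : Ideal R) [p.IsPrime] :
    p.height ≤ (p.under A).height := by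
  have hmono : StrictMono (PrimeSpectrum.comap (algebraMap A R)) := fun I J hIJ =>
    Ideal.IsIntegral.comap_lt_comap (R := A) (I := I.asIdeal) (J := J.asIdeal) hIJ
  have := Order.height_le_height_apply_of_strictMono _ hmono ⟨p, ‹_›⟩
  rwa [← PrimeSpectrum.height_eq_orderHeight, ← PrimeSpectrum.height_eq_orderHeight] at this

theorem isWeaklyRegular_localization_of_flat {A R : Type*} [CommRing A] [CommRing R]
    [Algebra A R] [Module.Flat A R] (q : Ideal A) [q.IsPrime] (p : Ideal R) [p.IsPrime]
    [p.LiesOver q] {rs : List (Localization.AtPrime q)}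
    (hmem : ∀ r ∈ rs, r ∈ maximalIdeal (Localization.AtPrime q))
    (hreg : IsWeaklyRegular (Localization.AtPrime q) rs) :
    ∃ ss : List (Localization.AtPrime p), ss.length = rs.length ∧
      (∀ s ∈ ss, s ∈ maximalIdeal (Localization.AtPrime p)) ∧
      IsWeaklyRegular (Localization.AtPrime p) ss := by
  let := Localization.AtPrime.algebraOfLiesOver q p
  refine ⟨rs.map (algebraMap _ _), by simp, ?_, hreg.of_flat⟩
  intro s hs
  obtain ⟨r, hr, rfl⟩ := List.mem_map.mp hs
  exact map_nonunit (algebraMap (Localization.AtPrime q) (Localization.AtPrime p)) r (hmem r hr)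

theorem IsCohenMacaulayRing.of_flat_of_isIntegral {A R : Type*} [CommRing A] [CommRing R]
    [Algebra A R] [IsNoetherianRing R] [Module.Flat A R] [Algebra.IsIntegral A R]
    (h : IsCohenMacaulayRing A) : IsCohenMacaulayRing R := by
  have := h.1
  rw [isCohenMacaulayRing_iff] at h ⊢
  intro p hp
  obtain ⟨rs, hmem, hreg, hdim⟩ := h (p.under A)
  obtain ⟨ss, hlen, hmem', hreg'⟩ :=
    isWeaklyRegular_localization_of_flat (p.under A) p hmem hreg
  refine ⟨ss, hmem', hreg', ?_⟩
  rw [IsLocalization.AtPrime.ringKrullDim_eq_height p, hlen]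
  rw [IsLocalization.AtPrime.ringKrullDim_eq_height (p.under A)] at hdim
  exact (WithBot.coe_le_coe.mpr (height_le_height_under_of_isIntegral p)).trans hdim

end CohenMacaulay

/-! ## Restrictions and stars -/

namespace FaceComplex

variable {V : Type u}

/-- The subcomplex of the faces contained in `W`. -/
def restrict (Δ : FaceComplex V) (W : Finset V) : FaceComplex V where
  faces := {F | F ∈ Δ.faces ∧ F ⊆ W}
  empty_mem := ⟨Δ.empty_mem, Finset.empty_subset W⟩
  down_closed := fun _ _ hF hHF => ⟨Δ.down_closed hF.1 hHF, hHF.trans hF.2⟩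

theorem restrict_univ [Fintype V] (Δ : FaceComplex V) : Δ.restrict Finset.univ = Δ := by
  ext F
  simp [restrict]

theorem isSimplex_restrict {Δ : FaceComplex V} {W : Finset V} (hW : W ∈ Δ.faces) :
    (Δ.restrict W).IsSimplex :=
  ⟨W, fun _ => ⟨fun hF => hF.2, fun hF => ⟨Δ.down_closed hW hF, hF⟩⟩⟩

theorem mem_indepFaceComplex {G : SimpleGraph V} {F : Finset V} :
    F ∈ G.indepFaceComplex.faces ↔ ∀ a ∈ F, ∀ b ∈ F, ¬ G.Adj a b := by
  change Gᶜ.IsClique F ↔ _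
  rw [SimpleGraph.isClique_compl]
  exact ⟨fun h a ha b hb hab => h ha hb hab.ne hab, fun h a ha b hb _ => h a ha b hb⟩

variable [DecidableEq V]

/-- The closed star of a vertex `x`: the faces whose union with `x` is a face. -/
def star (Δ : FaceComplex V) (x : V) (hx : Δ.IsVertex x) : FaceComplex V where
  faces := {F | insert x F ∈ Δ.faces}
  empty_mem := hx
  down_closed := fun _ _ hF hHF => Δ.down_closed hF (Finset.insert_subset_insert x hHF)

theorem deletion_restrict (Δ : FaceComplex V) (W : Finset V) (x : V) :
    (Δ.restrict W).deletion x = Δ.restrict (W.erase x) := by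
  ext F
  simp only [deletion, restrict, Set.mem_ofPred_eq, Finset.subset_erase, and_assoc]

theorem deletion_star (Δ : FaceComplex V) (x : V) (hx : Δ.IsVertex x) :
    (Δ.star x hx).deletion x = Δ.link x hx := by
  ext F
  have hF : insert x F ∈ Δ.faces → F ∈ Δ.faces :=
    fun h => Δ.down_closed h (Finset.subset_insert x F)
  change insert x F ∈ Δ.faces ∧ x ∉ F ↔ F ∈ Δ.faces ∧ x ∉ F ∧ insert x F ∈ Δ.faces
  tauto

theorem IsVertexDecomposable.of_insert_mem {Δ : FaceComplex V} {x y : V} (hx : Δ.IsVertex x)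
    (hdel : (Δ.deletion x).IsVertexDecomposable) (hlink : (Δ.link x hx).IsVertexDecomposable)
    (hxy : {x, y} ∉ Δ.faces) (hy : ∀ F ∈ Δ.faces, x ∉ F → insert y F ∈ Δ.faces) :
    Δ.IsVertexDecomposable := by
  refine .shedding Δ x hx hdel hlink fun F hF hF' => ?_
  obtain ⟨hFΔ, hxF, hxFΔ⟩ := hF.prop
  have hyx : x ≠ y := fun h => hxy (by simpa [← h, IsVertex] using hx)
  have hyF : y ∉ F := fun h => hxy <| Δ.down_closed hxFΔ <|
    Finset.insert_subset_insert x (Finset.singleton_subset_iff.mpr h)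
  have hyFdel : insert y F ∈ (Δ.deletion x).faces := ⟨hy F hFΔ hxF, by simp [hyx, hxF]⟩
  exact hyF (hF'.le_of_ge hyFdel (Finset.subset_insert y F) (Finset.mem_insert_self y F))

section IndependenceComplex

variable {G : SimpleGraph V} {W : Finset V} {x y : V}

theorem insert_mem_indepFaceComplex {F : Finset V} :
    insert x F ∈ G.indepFaceComplex.faces ↔
      F ∈ G.indepFaceComplex.faces ∧ ∀ a ∈ F, ¬ G.Adj x a := by
  simp only [mem_indepFaceComplex, Finset.forall_mem_insert, G.loopless.irrefl x,
    G.adj_comm _ x, not_false_eq_true, true_and, forall_and]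
  tauto

omit [DecidableEq V] in
theorem isVertex_restrict_indepFaceComplex (hx : x ∈ W) :
    (G.indepFaceComplex.restrict W).IsVertex x :=
  ⟨mem_indepFaceComplex.mpr (by simp), Finset.singleton_subset_iff.mpr hx⟩

variable [DecidableRel G.Adj]

theorem star_restrict_indepFaceComplex (hx : x ∈ W)
    (hv : (G.indepFaceComplex.restrict W).IsVertex x) :
    (G.indepFaceComplex.restrict W).star x hv =
      G.indepFaceComplex.restrict (W.filter (¬ G.Adj x ·)) := by
  ext F
  change insert x F ∈ G.indepFaceComplex.faces ∧ insert x F ⊆ W ↔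
    F ∈ G.indepFaceComplex.faces ∧ F ⊆ W.filter (¬ G.Adj x ·)
  simp only [insert_mem_indepFaceComplex, Finset.subset_iff, Finset.mem_filter,
    Finset.forall_mem_insert, hx, true_and, forall_and]
  tauto

theorem isVertexDecomposable_restrict_indepFaceComplex_of_leaf (hx : x ∈ W) (hy : y ∈ W)
    (hxy : G.Adj x y) (hleaf : ∀ z ∈ W, G.Adj z y → z = x)
    (hdel : (G.indepFaceComplex.restrict (W.erase x)).IsVertexDecomposable)
    (hlink : (G.indepFaceComplex.restrict
      ((W.filter (¬ G.Adj x ·)).erase x)).IsVertexDecomposable) :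
    (G.indepFaceComplex.restrict W).IsVertexDecomposable := by
  refine .of_insert_mem (y := y) (isVertex_restrict_indepFaceComplex hx)
    (by rwa [deletion_restrict])
    (by rwa [← deletion_star, star_restrict_indepFaceComplex hx, deletion_restrict]) ?_ ?_
  · exact fun h => mem_indepFaceComplex.mp h.1 x (by simp) y (by simp) hxy
  · rintro F ⟨hF, hFW⟩ hxF
    refine ⟨insert_mem_indepFaceComplex.mpr ⟨hF, fun z hz hyz => ?_⟩,
      Finset.insert_subset hy hFW⟩
    exact hxF (hleaf z (hFW hz) hyz.symm ▸ hz)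

end IndependenceComplex

end FaceComplex

/-! ## Orthogonality graphs -/

/-- `G` is the orthogonality graph of the proper part of an orthoposet with orthocomplementation
`σ`: two elements are adjacent when each lies below the orthocomplement of the other. The symmetry
of `G` makes `σ` antitone, and looplessness says that no element lies below its complement. -/
structure IsOrthogonalityGraph {V : Type u} [PartialOrder V] (G : SimpleGraph V) (σ : V → V) :
    Prop where
  involutive : Function.Involutive σ
  adj_iff : ∀ {a b : V}, G.Adj a b ↔ a ≤ σ b

namespace IsOrthogonalityGraph

variable {V : Type u} {G : SimpleGraph V} {σ : V → V}

/-- A set of vertices is peeled if each of its vertices whose orthocomplement is missing is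
isolated in it. The property passes to the deletion, the star and the link of the neighbour of a
leaf. -/
def IsPeeled (G : SimpleGraph V) (σ : V → V) (W : Finset V) : Prop :=
  ∀ a ∈ W, σ a ∉ W → ∀ b ∈ W, ¬ G.Adj a b

/-- The vertex set contains at least one element of every orthocomplementary pair. -/
def MeetsPairs (σ : V → V) (W : Finset V) : Prop := ∀ a, a ∈ W ∨ σ a ∈ W

theorem isPeeled_univ [Fintype V] : IsPeeled G σ Finset.univ :=
  fun a _ hσa => (hσa (Finset.mem_univ (σ a))).elim

variable [PartialOrder V]

theorem adj_apply_iff (h : IsOrthogonalityGraph G σ) {a b : V} : G.Adj a (σ b) ↔ a ≤ b := by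
  rw [h.adj_iff, h.involutive]

theorem adj_apply_self (h : IsOrthogonalityGraph G σ) (a : V) : G.Adj a (σ a) :=
  h.adj_apply_iff.mpr le_rfl

theorem adj_of_le (h : IsOrthogonalityGraph G σ) {a b c : V} (hab : a ≤ b) (hbc : G.Adj b c) :
    G.Adj a c :=
  h.adj_iff.mpr (hab.trans (h.adj_iff.mp hbc))

section Peeling

variable (h : IsOrthogonalityGraph G σ) {W : Finset V} {x : V}
include h

theorem isPeeled_erase [DecidableEq V] (hW : IsPeeled G σ W)
    (hleaf : ∀ z ∈ W, G.Adj z (σ x) → z = x) : IsPeeled G σ (W.erase x) := by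
  intro a ha hσa b hb hab
  rw [Finset.mem_erase] at ha hb
  by_cases hσaW : σ a ∈ W
  · have hax : σ a = x := by
      by_contra hne
      exact hσa (Finset.mem_erase.mpr ⟨hne, hσaW⟩)
    exact hb.1 (hleaf b hb.2 (h.involutive.eq_iff.mp hax ▸ hab.symm))
  · exact hW a ha.2 hσaW b hb.2 hab

theorem meetsPairs_erase [DecidableEq V] (hW : MeetsPairs σ W) (hσx : σ x ∈ W) :
    MeetsPairs σ (W.erase x) := by
  intro a
  have hne : σ a ≠ a := (h.adj_apply_self a).ne'
  simp only [Finset.mem_erase]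
  by_cases ha : a = x
  · subst ha
    exact Or.inr ⟨hne, hσx⟩
  · by_cases hσa : σ a = x
    · subst hσa
      exact Or.inl ⟨ha, h.involutive a ▸ hσx⟩
    · exact (hW a).imp (⟨ha, ·⟩) (⟨hσa, ·⟩)

theorem isPeeled_filter [DecidableRel G.Adj] (hW : IsPeeled G σ W) :
    IsPeeled G σ (W.filter (¬ G.Adj x ·)) := by
  intro a ha hσa b hb hab
  rw [Finset.mem_filter] at ha hb hσa
  by_cases hσaW : σ a ∈ W
  · have hxa : x ≤ a := h.adj_apply_iff.mp (not_not.mp fun hne => hσa ⟨hσaW, hne⟩)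
    exact hb.2 (h.adj_of_le hxa hab)
  · exact hW a ha.1 hσaW b hb.1 hab

theorem meetsPairs_filter [DecidableRel G.Adj] (hP : IsPeeled G σ W) (hW : MeetsPairs σ W)
    (hx : x ∈ W) : MeetsPairs σ (W.filter (¬ G.Adj x ·)) := by
  have apply_mem {a : V} (ha : a ∈ W) (hxa : G.Adj x a) : σ a ∈ W.filter (¬ G.Adj x ·) := by
    have hσa : σ a ∈ W := by
      by_contra hσa
      exact hP a ha hσa x hx hxa.symm
    refine Finset.mem_filter.mpr ⟨hσa, fun hxσa => G.loopless.irrefl x ?_⟩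
    exact h.adj_of_le (h.adj_apply_iff.mp hxσa) hxa.symm
  have mem_or_apply_mem {a : V} (ha : a ∈ W) :
      a ∈ W.filter (¬ G.Adj x ·) ∨ σ a ∈ W.filter (¬ G.Adj x ·) := by
    by_cases hxa : G.Adj x a
    · exact Or.inr (apply_mem ha hxa)
    · exact Or.inl (Finset.mem_filter.mpr ⟨ha, hxa⟩)
  intro a
  obtain ha | hσa := hW a
  · exact mem_or_apply_mem ha
  · simpa only [h.involutive a] using (mem_or_apply_mem hσa).symm

theorem peel_induction [DecidableEq V] [DecidableRel G.Adj] {motive : Finset V → Prop}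
    (independent : ∀ W, (∀ a ∈ W, ∀ b ∈ W, ¬ G.Adj a b) → motive W)
    (leaf : ∀ W x, IsPeeled G σ W → x ∈ W → σ x ∈ W → (∀ z ∈ W, G.Adj z (σ x) → z = x) →
      motive (W.erase x) → motive (W.filter (¬ G.Adj x ·)) →
      motive ((W.filter (¬ G.Adj x ·)).erase x) → motive W) (hW : IsPeeled G σ W) :
    motive W := by
  induction W using Finset.strongInduction with
  | H W ih =>
    by_cases hpair : (W.filter (σ · ∈ W)).Nonempty
    · -- A minimal `x` among the vertices of such pairs is the only neighbour of `σ x`.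
      obtain ⟨x, hmin⟩ := (W.filter (σ · ∈ W)).exists_minimal hpair
      obtain ⟨hx, hσx⟩ := Finset.mem_filter.mp hmin.prop
      have hleaf : ∀ z ∈ W, G.Adj z (σ x) → z = x := by
        intro z hz hadj
        have hσz : σ z ∈ W := by
          by_contra hσz
          exact hW z hz hσz _ hσx hadj
        exact hmin.eq_of_le (Finset.mem_filter.mpr ⟨hz, hσz⟩) (h.adj_apply_iff.mp hadj)
      have hfilter : W.filter (¬ G.Adj x ·) ⊂ W :=
        Finset.filter_ssubset.mpr ⟨σ x, hσx, not_not.mpr (h.adj_apply_self x)⟩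
      have hpeeled := h.isPeeled_filter (x := x) hW
      refine leaf W x hW hx hσx hleaf
        (ih _ (Finset.erase_ssubset hx) (h.isPeeled_erase hW hleaf))
        (ih _ hfilter hpeeled)
        (ih _ ((Finset.erase_subset _ _).trans_ssubset hfilter) ?_)
      exact h.isPeeled_erase hpeeled fun z hz => hleaf z (Finset.mem_filter.mp hz).1
    · refine independent W fun a ha => hW a ha fun hσa => hpair ⟨a, ?_⟩
      exact Finset.mem_filter.mpr ⟨ha, hσa⟩

theorem isVertexDecomposable_restrict [DecidableEq V] (hW : IsPeeled G σ W) :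
    (G.indepFaceComplex.restrict W).IsVertexDecomposable := by
  classical
  refine h.peel_induction
    (motive := fun W => (G.indepFaceComplex.restrict W).IsVertexDecomposable) ?_ ?_ hW
  · intro W hind
    exact .simplex _ (FaceComplex.isSimplex_restrict (FaceComplex.mem_indepFaceComplex.mpr hind))
  · intro W x _ hx hσx hleaf hdel _ hlink
    exact FaceComplex.isVertexDecomposable_restrict_indepFaceComplex_of_leaf hx hσx
      (h.adj_apply_self x) hleaf hdel hlink

end Peeling

theorem isVertexDecomposable [Finite V] [DecidableEq V] (h : IsOrthogonalityGraph G σ) :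
    G.IsVertexDecomposable := by
  classical
  cases nonempty_fintype V
  have hdec := h.isVertexDecomposable_restrict isPeeled_univ
  rwa [FaceComplex.restrict_univ] at hdec

end IsOrthogonalityGraph

/-! ## Stanley–Reisner rings -/

theorem projective_of_exact {A M N P : Type*} [Ring A] [AddCommGroup M] [AddCommGroup N]
    [AddCommGroup P] [Module A M] [Module A N] [Module A P] [Module.Projective A M]
    [Module.Projective A P] {f : M →ₗ[A] N} {g : N →ₗ[A] P} (hf : Function.Injective f)
    (hfg : Function.Exact f g) (hg : Function.Surjective g) : Module.Projective A N := by
  obtain ⟨l, hl⟩ := Module.projective_lifting_property g LinearMap.id hg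
  obtain ⟨e, -, -⟩ := hfg.splitSurjectiveEquiv hf ⟨l, hl⟩
  exact .of_equiv e.symm

theorem sum_single_one_le_iff {V : Type*} {F : Finset V} {m : V →₀ ℕ} :
    ∑ i ∈ F, Finsupp.single i 1 ≤ m ↔ F ⊆ m.support := by
  classical
  refine forall_congr' fun i => ?_
  rw [Finsupp.finsetSum_apply]
  by_cases hi : i ∈ F
  · simp [Finsupp.single_apply, hi, Nat.one_le_iff_ne_zero]
  · simp [Finsupp.single_apply, hi]

namespace FaceComplex

open MvPolynomial

variable {V : Type u} {K : Type v} [Field K] {Δ : FaceComplex V} {x : V}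

theorem prod_X_mem_stanleyReisnerIdeal {F : Finset V} (hF : F ∉ Δ.faces) :
    ∏ i ∈ F, X i ∈ Δ.stanleyReisnerIdeal K :=
  Ideal.subset_span ⟨F, hF, rfl⟩

theorem X_mem_stanleyReisnerIdeal (hx : ¬ Δ.IsVertex x) : X x ∈ Δ.stanleyReisnerIdeal K := by
  simpa only [Finset.prod_singleton] using prod_X_mem_stanleyReisnerIdeal hx

theorem stanleyReisnerIdeal_le_iff {I : Ideal (MvPolynomial V K)} :
    Δ.stanleyReisnerIdeal K ≤ I ↔ ∀ F ∉ Δ.faces, ∏ i ∈ F, X i ∈ I :=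
  Ideal.span_le.trans ⟨fun h F hF => h ⟨F, hF, rfl⟩, fun h _ ⟨F, hF, hm⟩ => hm ▸ h F hF⟩

theorem mem_stanleyReisnerIdeal_iff {f : MvPolynomial V K} :
    f ∈ Δ.stanleyReisnerIdeal K ↔ ∀ m ∈ f.support, m.support ∉ Δ.faces := by
  have hgen : {m : MvPolynomial V K | ∃ F : Finset V, F ∉ Δ.faces ∧ m = ∏ i ∈ F, X i} =
      (monomial · 1) '' {s | ∃ F : Finset V, F ∉ Δ.faces ∧ ∑ i ∈ F, Finsupp.single i 1 = s} := by
    ext m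
    simp only [Set.mem_ofPred_eq, Set.mem_image, exists_exists_and_eq_and, monomial_sum_one,
      eq_comm (a := m)]
    rfl
  rw [stanleyReisnerIdeal, hgen, mem_ideal_span_monomial_image]
  refine forall₂_congr fun m _ => ?_
  simp only [Set.mem_ofPred_eq, exists_exists_and_eq_and, sum_single_one_le_iff]
  exact ⟨fun ⟨F, hF, hFm⟩ hm => hF (Δ.down_closed hm hFm), fun hm => ⟨m.support, hm, subset_rfl⟩⟩

theorem stanleyReisnerIdeal_le_deletion :
    Δ.stanleyReisnerIdeal K ≤ (Δ.deletion x).stanleyReisnerIdeal K :=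
  stanleyReisnerIdeal_le_iff.mpr fun _ hF => prod_X_mem_stanleyReisnerIdeal fun h => hF h.1

theorem X_mem_stanleyReisnerIdeal_deletion : X x ∈ (Δ.deletion x).stanleyReisnerIdeal K :=
  X_mem_stanleyReisnerIdeal fun h => h.2 (Finset.mem_singleton_self x)

theorem stanleyReisnerIdeal_deletion_le :
    (Δ.deletion x).stanleyReisnerIdeal K ≤ Δ.stanleyReisnerIdeal K ⊔ Ideal.span {X x} := by
  refine stanleyReisnerIdeal_le_iff.mpr fun F hF => ?_
  by_cases hFΔ : F ∈ Δ.faces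
  · have hx : x ∈ F := by
      by_contra hx
      exact hF ⟨hFΔ, hx⟩
    exact Ideal.mem_sup_right (Ideal.mem_span_singleton.mpr (Finset.dvd_prod_of_mem _ hx))
  · exact Ideal.mem_sup_left (prod_X_mem_stanleyReisnerIdeal hFΔ)

variable (K Δ x) in
/-- The projection onto the Stanley–Reisner ring of the deletion of `x`; it is the second map of
the exact sequence `0 → K[star x] → K[Δ] → K[Δ \ x] → 0`. -/
noncomputable def toDeletion :
    Δ.StanleyReisnerRing K →ₗ[MvPolynomial V K] (Δ.deletion x).StanleyReisnerRing K :=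
  Submodule.mapQ _ _ LinearMap.id stanleyReisnerIdeal_le_deletion

theorem toDeletion_mk (f : MvPolynomial V K) :
    toDeletion K Δ x (Ideal.Quotient.mk _ f) = Ideal.Quotient.mk _ f := rfl

theorem toDeletion_surjective : Function.Surjective (toDeletion K Δ x) := fun f => by
  obtain ⟨f, rfl⟩ := Ideal.Quotient.mk_surjective f
  exact ⟨Ideal.Quotient.mk _ f, toDeletion_mk f⟩

variable [DecidableEq V]

theorem X_mul_mem_stanleyReisnerIdeal_iff (hx : Δ.IsVertex x) {f : MvPolynomial V K} :
    X x * f ∈ Δ.stanleyReisnerIdeal K ↔ f ∈ (Δ.star x hx).stanleyReisnerIdeal K := by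
  have hsupp (m : V →₀ ℕ) : (Finsupp.single x 1 + m).support = insert x m.support := by
    ext i
    by_cases hi : i = x
    · simp [hi]
    · simp [hi]
  simp [mem_stanleyReisnerIdeal_iff, support_X_mul, star, hsupp]

variable (K Δ x) in
/-- Multiplication by `X x` as a map from the Stanley–Reisner ring of the star of `x`; it is the
first map of the exact sequence `0 → K[star x] → K[Δ] → K[Δ \ x] → 0`. -/
noncomputable def starMulX (hx : Δ.IsVertex x) :
    (Δ.star x hx).StanleyReisnerRing K →ₗ[MvPolynomial V K] Δ.StanleyReisnerRing K :=
  Submodule.mapQ _ _ (LinearMap.mulLeft _ (X x)) fun _ =>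
    (X_mul_mem_stanleyReisnerIdeal_iff hx).mpr

theorem starMulX_mk (hx : Δ.IsVertex x) (f : MvPolynomial V K) :
    starMulX K Δ x hx (Ideal.Quotient.mk _ f) = Ideal.Quotient.mk _ (X x * f) := rfl

theorem starMulX_injective (hx : Δ.IsVertex x) : Function.Injective (starMulX K Δ x hx) := by
  refine (injective_iff_map_eq_zero _).mpr fun f => ?_
  obtain ⟨f, rfl⟩ := Ideal.Quotient.mk_surjective f
  rw [starMulX_mk, Ideal.Quotient.eq_zero_iff_mem, Ideal.Quotient.eq_zero_iff_mem]
  exact (X_mul_mem_stanleyReisnerIdeal_iff hx).mp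

theorem exact_starMulX_toDeletion (hx : Δ.IsVertex x) :
    Function.Exact (starMulX K Δ x hx) (toDeletion K Δ x) := by
  intro f
  obtain ⟨f, rfl⟩ := Ideal.Quotient.mk_surjective f
  rw [toDeletion_mk, Ideal.Quotient.eq_zero_iff_mem]
  constructor
  · intro hf
    obtain ⟨a, ha, b, hb, rfl⟩ := Submodule.mem_sup.mp (stanleyReisnerIdeal_deletion_le hf)
    obtain ⟨c, rfl⟩ := Ideal.mem_span_singleton.mp hb
    refine ⟨Ideal.Quotient.mk _ c, ?_⟩
    rw [starMulX_mk, map_add, Ideal.Quotient.eq_zero_iff_mem.mpr ha, zero_add]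
  · rintro ⟨g, hg⟩
    obtain ⟨g, rfl⟩ := Ideal.Quotient.mk_surjective g
    rw [starMulX_mk, Ideal.Quotient.eq] at hg
    have hXg := Ideal.mul_mem_right g _ (X_mem_stanleyReisnerIdeal_deletion (Δ := Δ) (x := x))
    simpa using sub_mem hXg (stanleyReisnerIdeal_le_deletion hg)

theorem projective_stanleyReisnerRing_of_star_of_deletion (A : Type*) [CommRing A]
    [Algebra A (MvPolynomial V K)] (hx : Δ.IsVertex x)
    [Module.Projective A ((Δ.star x hx).StanleyReisnerRing K)]
    [Module.Projective A ((Δ.deletion x).StanleyReisnerRing K)] :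
    Module.Projective A (Δ.StanleyReisnerRing K) :=
  projective_of_exact (f := (starMulX K Δ x hx).restrictScalars A)
    (g := (toDeletion K Δ x).restrictScalars A) (starMulX_injective hx)
    (exact_starMulX_toDeletion hx) toDeletion_surjective

end FaceComplex

namespace IsOrthogonalityGraph

open MvPolynomial FaceComplex

variable {V : Type u} {σ : V → V}

section PairSums

variable (σ) in
/-- The unordered pairs `{a, σ a}`. -/
abbrev OrthoPair : Type u := Set.range fun a => s(a, σ a)

variable (σ) in
/-- The pair `{a, σ a}` of `a`. -/
def orthoPair (a : V) : OrthoPair σ := ⟨s(a, σ a), a, rfl⟩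

theorem orthoPair_apply (hσ : Function.Involutive σ) (a : V) :
    orthoPair σ (σ a) = orthoPair σ a :=
  Subtype.ext (by simp only [orthoPair, hσ a, Sym2.eq_swap])

variable (K : Type v) [Field K]

variable (σ) in
/-- The sums `X a + X (σ a)` as a map from the polynomial ring with one variable for each pair.
They play the role of a system of parameters of the Stanley–Reisner ring. -/
noncomputable def pairSum : MvPolynomial (OrthoPair σ) K →ₐ[K] MvPolynomial V K :=
  aeval fun p => Sym2.lift ⟨fun a b => X a + X b, fun a b => add_comm (X a) (X b)⟩ p.1

theorem pairSum_X (a : V) : pairSum σ K (X (orthoPair σ a)) = X a + X (σ a) := by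
  rw [pairSum, aeval_X, orthoPair, Sym2.lift_mk]

/-- The polynomial ring of the vertices as an algebra over the polynomial ring of the pairs. -/
noncomputable abbrev pairAlgebra :
    Algebra (MvPolynomial (OrthoPair σ) K) (MvPolynomial V K) :=
  (pairSum σ K).toRingHom.toAlgebra

attribute [local instance] pairAlgebra

theorem algebraMap_stanleyReisnerRing (Δ : FaceComplex V) (f : MvPolynomial (OrthoPair σ) K) :
    algebraMap (MvPolynomial (OrthoPair σ) K) (Δ.StanleyReisnerRing K) f =
      Ideal.Quotient.mk (Δ.stanleyReisnerIdeal K) (pairSum σ K f) := rfl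

section Transversal

variable {K} {W : Finset V} {Δ : FaceComplex V}

variable (σ K W) in
open scoped Classical in
/-- The map that sends the variables of `W` to those of their pairs and kills the others. For a
simplex on a transversal `W` of the pairs it induces the inverse of the structure map of its
Stanley–Reisner ring. -/
noncomputable def pairRetraction : MvPolynomial V K →ₐ[K] MvPolynomial (OrthoPair σ) K :=
  aeval fun a => if a ∈ W then X (orthoPair σ a) else 0

theorem pairRetraction_eq_zero (hΔ : ∀ F ⊆ W, F ∈ Δ.faces) {f : MvPolynomial V K}
    (hf : f ∈ Δ.stanleyReisnerIdeal K) : pairRetraction σ K W f = 0 := by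
  suffices h : Δ.stanleyReisnerIdeal K ≤ RingHom.ker (pairRetraction σ K W) from h hf
  refine stanleyReisnerIdeal_le_iff.mpr fun F hF => ?_
  obtain ⟨a, haF, haW⟩ := Finset.not_subset.mp (mt (hΔ F) hF)
  rw [RingHom.mem_ker, map_prod]
  exact Finset.prod_eq_zero haF (by rw [pairRetraction, aeval_X, if_neg haW])

theorem pairRetraction_pairSum (hσ : Function.Involutive σ) (hW : ∀ a, a ∈ W ↔ σ a ∉ W)
    (f : MvPolynomial (OrthoPair σ) K) : pairRetraction σ K W (pairSum σ K f) = f := by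
  suffices h : (pairRetraction σ K W).comp (pairSum σ K) = AlgHom.id K _ from
    DFunLike.congr_fun h f
  refine algHom_ext fun ⟨_, a, rfl⟩ => ?_
  change pairRetraction σ K W (pairSum σ K (X (orthoPair σ a))) = X (orthoPair σ a)
  rw [pairSum_X, map_add, pairRetraction, aeval_X, aeval_X, orthoPair_apply hσ]
  by_cases ha : a ∈ W
  · rw [if_pos ha, if_neg ((hW a).mp ha), add_zero]
  · rw [if_neg ha, if_pos (not_not.mp (mt (hW a).mpr ha)), zero_add]

theorem mk_pairSum_pairRetraction (hW : ∀ a ∈ W, σ a ∉ W) (hΔ : ∀ a ∉ W, ¬ Δ.IsVertex a)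
    (f : MvPolynomial V K) :
    Ideal.Quotient.mk (Δ.stanleyReisnerIdeal K) (pairSum σ K (pairRetraction σ K W f)) =
      Ideal.Quotient.mk (Δ.stanleyReisnerIdeal K) f := by
  let mk := Ideal.Quotient.mkₐ K (Δ.stanleyReisnerIdeal K)
  have mk_X (a : V) (ha : a ∉ W) : mk (X a) = 0 :=
    Ideal.Quotient.eq_zero_iff_mem.mpr (X_mem_stanleyReisnerIdeal (hΔ a ha))
  suffices h : (mk.comp (pairSum σ K)).comp (pairRetraction σ K W) = mk from DFunLike.congr_fun h f
  refine algHom_ext fun a => ?_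
  rw [AlgHom.comp_apply, AlgHom.comp_apply, pairRetraction, aeval_X]
  by_cases ha : a ∈ W
  · rw [if_pos ha, pairSum_X, map_add, mk_X _ (hW a ha), add_zero]
  · rw [if_neg ha, map_zero, map_zero, mk_X a ha]

theorem projective_stanleyReisnerRing_of_transversal (hσ : Function.Involutive σ)
    (hW : ∀ a, a ∈ W ↔ σ a ∉ W) (hΔ : ∀ F, F ∈ Δ.faces ↔ F ⊆ W) :
    Module.Projective (MvPolynomial (OrthoPair σ) K) (Δ.StanleyReisnerRing K) := by
  have hbij : Function.Bijective
      (Algebra.linearMap (MvPolynomial (OrthoPair σ) K) (Δ.StanleyReisnerRing K)) := by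
    constructor
    · refine (injective_iff_map_eq_zero _).mpr fun f hf => ?_
      rw [Algebra.linearMap_apply, algebraMap_stanleyReisnerRing,
        Ideal.Quotient.eq_zero_iff_mem] at hf
      rw [← pairRetraction_pairSum hσ hW f]
      exact pairRetraction_eq_zero (fun F => (hΔ F).mpr) hf
    · intro f
      obtain ⟨f, rfl⟩ := Ideal.Quotient.mk_surjective f
      refine ⟨pairRetraction σ K W f, mk_pairSum_pairRetraction (fun a => (hW a).mp) ?_ f⟩
      exact fun a ha hv => ha (Finset.singleton_subset_iff.mp ((hΔ _).mp hv))
  exact .of_equiv (LinearEquiv.ofBijective _ hbij)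

end Transversal

section Integrality

variable {K} {Δ : FaceComplex V}

theorem isIntegral_mk_X {a : V} (ha : X a * X (σ a) ∈ Δ.stanleyReisnerIdeal K) :
    IsIntegral (MvPolynomial (OrthoPair σ) K)
      (Ideal.Quotient.mk (Δ.stanleyReisnerIdeal K) (X a)) := by
  refine ⟨Polynomial.X * (Polynomial.X - Polynomial.C (X (orthoPair σ a))),
    Polynomial.monic_X.mul (Polynomial.monic_X_sub_C _), ?_⟩
  rw [Polynomial.eval₂_mul, Polynomial.eval₂_sub, Polynomial.eval₂_X, Polynomial.eval₂_C,
    algebraMap_stanleyReisnerRing, pairSum_X, ← map_sub, ← map_mul,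
    Ideal.Quotient.eq_zero_iff_mem, sub_add_cancel_left, mul_neg]
  exact neg_mem ha

theorem isIntegral_stanleyReisnerRing
    (hΔ : ∀ a, X a * X (σ a) ∈ Δ.stanleyReisnerIdeal K) :
    Algebra.IsIntegral (MvPolynomial (OrthoPair σ) K) (Δ.StanleyReisnerRing K) := by
  refine ⟨fun f => ?_⟩
  obtain ⟨f, rfl⟩ := Ideal.Quotient.mk_surjective f
  induction f using MvPolynomial.induction_on with
  | C a =>
    rw [show C a = pairSum σ K (C a) from (algHom_C _ a).symm, ← algebraMap_stanleyReisnerRing]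
    exact isIntegral_algebraMap
  | add p q hp hq =>
    rw [map_add]
    exact hp.add hq
  | mul_X p a hp =>
    rw [map_mul]
    exact hp.mul (isIntegral_mk_X (hΔ a))

end Integrality

variable {K} [PartialOrder V] {G : SimpleGraph V} (h : IsOrthogonalityGraph G σ)
include h

theorem projective_stanleyReisnerRing_restrict {W : Finset V} (hP : IsPeeled G σ W)
    (hW : MeetsPairs σ W) : Module.Projective (MvPolynomial (OrthoPair σ) K)
      ((G.indepFaceComplex.restrict W).StanleyReisnerRing K) := by
  classical
  revert hW
  refine h.peel_induction (motive := fun W => MeetsPairs σ W → Module.Projective _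
    ((G.indepFaceComplex.restrict W).StanleyReisnerRing K)) ?_ ?_ hP
  · intro W hind hW
    refine projective_stanleyReisnerRing_of_transversal h.involutive (W := W) (fun a => ?_)
      fun F => ?_
    · exact ⟨fun ha hσa => hind a ha _ hσa (h.adj_apply_self a), (hW a).resolve_right⟩
    · refine and_iff_right_of_imp fun hF => mem_indepFaceComplex.mpr fun a ha b hb => ?_
      exact hind a (hF ha) b (hF hb)
  · intro W x hP hx hσx _ hdel hstar _ hW
    have hv := isVertex_restrict_indepFaceComplex (G := G) hx
    rw [← deletion_restrict] at hdel
    rw [← star_restrict_indepFaceComplex hx hv] at hstar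
    have := hdel (h.meetsPairs_erase hW hσx)
    have := hstar (h.meetsPairs_filter hP hW hx)
    exact projective_stanleyReisnerRing_of_star_of_deletion _ hv

theorem X_mul_X_mem_stanleyReisnerIdeal (a : V) :
    X a * X (σ a) ∈ G.indepFaceComplex.stanleyReisnerIdeal K := by
  classical
  rw [← Finset.prod_pair (h.adj_apply_self a).ne]
  refine prod_X_mem_stanleyReisnerIdeal fun hF => ?_
  exact mem_indepFaceComplex.mp hF a (by simp) _ (by simp) (h.adj_apply_self a)

variable (K) in
theorem isCohenMacaulayOver [Finite V] : G.IsCohenMacaulayOver K := by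
  cases nonempty_fintype V
  have hproj := h.projective_stanleyReisnerRing_restrict (K := K) (W := .univ)
    isPeeled_univ fun a => .inl (Finset.mem_univ a)
  rw [restrict_univ] at hproj
  have := isIntegral_stanleyReisnerRing (h.X_mul_X_mem_stanleyReisnerIdeal (K := K))
  exact IsCohenMacaulayRing.of_flat_of_isIntegral
    (IsCohenMacaulayRing.of_isRegularRing (MvPolynomial (OrthoPair σ) K))

end PairSums

end IsOrthogonalityGraph

/-- The complement `Aᶜ`. -/
def BooleanVertex.compl {n : ℕ} (A : BooleanVertex n) : BooleanVertex n :=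
  ⟨A.1ᶜ, by simp [A.2.2], by simp [A.2.1]⟩

theorem booleanGraph.isOrthogonalityGraph (n : ℕ) :
    IsOrthogonalityGraph (booleanGraph n) BooleanVertex.compl where
  involutive A := Subtype.ext (compl_compl A.1)
  adj_iff := Finset.disjoint_iff_inter_eq_empty.symm.trans le_compl_iff_disjoint_right.symm

theorem theorem2p2_general {V : Type u} [Finite V] [DecidableEq V] [PartialOrder V]
    {G : SimpleGraph V} {σ : V → V} (h : IsOrthogonalityGraph G σ) :
    G.IsVertexDecomposable ∧ ∀ (K : Type v) [Field K], G.IsCohenMacaulayOver K :=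
  ⟨h.isVertexDecomposable, fun K _ => h.isCohenMacaulayOver K⟩

theorem theorem2p2 (n : ℕ) (hn : 1 ≤ n) :
    (booleanGraph n).IsVertexDecomposable ∧
      ∀ (K : Type u) [Field K], (booleanGraph n).IsCohenMacaulayOver K :=
  theorem2p2_general (booleanGraph.isOrthogonalityGraph n)
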